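/- Let $n\ge 0$, let $B_n$ be the Boolean algebra of subsets of $\{1,\dots,n\}$ ordered by inclusion and ranked by cardinality, and let $\mathcal E(B_n)$ be its edge poset: its elements are the pairs $(x,y)$ with $x\lessdot y$ in $B_n$, its order is the reflexive transitive closure of the relation "$x\lessdot x'$ and $y\lessdot y'$" between $(x,y)$ and $(x',y')$, and its rank function is $\operatorname{rk}(x,y)=|x|$. Let $G$ be any subgroup of the group $\operatorname{Aut}(B_n)$ of order automorphisms of $B_n$, acting on $\mathcal E(B_n)$ by $g\cdot(x,y)=(gx,gy)$. Let $\mathcal E(B_n)/G$ be the quotient poset: its elements are the $G$-orbits, $\mathcal O\le\mathcal O'$ if and only if $e\le e'$ for some $e\in\mathcal O$, $e'\in\mathcal O'$, and the rank of an orbit is the common rank of its elements. Then $\mathcal E(B_n)/G$ is Peck. Here a finite graded poset $P$ of rank $N$ (all ranks lie in $\{0,\dots,N\}$, and ranks $0$ and $N$ both occur), with $p_i$ elements of rank $i$, is Peck if it is rank-symmetric ($p_i=p_{N-i}$ for all $0\le i\le N$), rank-unimodal ($p_0\le\cdots\le p_k\ge\cdots\ge p_N$ for some $0\le k\le N$),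 and strongly Sperner (for every $k$, no union of $k$ disjoint antichains of $P$ has more elements than the union of the $k$ largest ranks of $P$). The empty poset, which arises for $n=0$, is Peck by convention. -/

import Mathlib

/-!
Finite graded posets are partial orders with Mathlib's class `GradeOrder ℕ P`: a rank function
`grade ℕ : P → ℕ` that is strictly monotone and increases by exactly one along every covering pair
(covering in `ℕ` means being the successor).
The Boolean algebra `B_n` is `Finset (Fin n)` ordered by inclusion and ranked by cardinality, and
`Aut(B_n)` is the group of order automorphisms `Finset (Fin n) ≃o Finset (Fin n)`.
-/

section RankConditions

variable (P : Type*) [PartialOrder P] [GradeOrder ℕ P]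

/-- The rank number `p_i`: how many elements have rank `i`. -/
noncomputable def rankNumber (i : ℕ) : ℕ := {x : P | grade ℕ x = i}.ncard

/-- `P` is a graded poset of rank `N`: the ranks lie in `0, …, N`, and both `0` and `N` occur.
(An empty poset, for which no rank can occur, is allowed by convention.) -/
def IsOfRank (N : ℕ) : Prop :=
  (∀ x : P, grade ℕ x ≤ N) ∧
    (Nonempty P → (∃ x : P, grade ℕ x = 0) ∧ (∃ y : P, grade ℕ y = N))

/-- `p_i = p_{N-i}` for all `0 ≤ i ≤ N`. -/
def IsRankSymmetric (N : ℕ) : Prop :=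
  ∀ i ≤ N, rankNumber P i = rankNumber P (N - i)

/-- `p_0 ≤ p_1 ≤ ⋯ ≤ p_k ≥ p_{k+1} ≥ ⋯ ≥ p_N` for some `0 ≤ k ≤ N`. -/
def IsRankUnimodal (N : ℕ) : Prop :=
  ∃ k ≤ N, (∀ i < k, rankNumber P i ≤ rankNumber P (i + 1)) ∧
    ∀ i, k ≤ i → i < N → rankNumber P (i + 1) ≤ rankNumber P i

/-- No union of `k` pairwise disjoint antichains is larger than the union of the `k` largest ranks,
i.e. some `k` ranks together have at least as many elements as that union. -/
def IsKSperner (k : ℕ) : Prop :=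
  ∀ A : Fin k → Set P, (∀ j, IsAntichain (· ≤ ·) (A j)) →
    (∀ i j, i ≠ j → Disjoint (A i) (A j)) →
      ∃ S : Finset ℕ, S.card = k ∧ (⋃ j, A j).ncard ≤ ∑ i ∈ S, rankNumber P i

/-- `k`-Sperner for every `k`. -/
def IsStronglySperner : Prop := ∀ k : ℕ, IsKSperner P k

/-- A finite graded poset is Peck if it is rank-symmetric, rank-unimodal and strongly Sperner. -/
def IsPeck [Finite P] : Prop :=
  ∃ N : ℕ, IsOfRank P N ∧ IsRankSymmetric P N ∧ IsRankUnimodal P N ∧ IsStronglySperner P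

end RankConditions

section EdgePoset

/-- The elements of the edge poset `ℰ(P)`: the edges `x ⋖ y` of the Hasse diagram of `P`. -/
@[ext]
structure EdgePoset (P : Type*) [PartialOrder P] where
  fst : P
  snd : P
  covBy : fst ⋖ snd

/-- In a graded poset, `x ⋖ y` says the same as `x ≤ y` and `rk y = rk x + 1`. -/
theorem covBy_iff_le_and_grade {P : Type*} [PartialOrder P] [GradeOrder ℕ P] (x y : P) :
    x ⋖ y ↔ x ≤ y ∧ grade ℕ y = grade ℕ x + 1 := by
  constructor
  · intro h
    have := Nat.covBy_iff_add_one_eq.1 (h.grade ℕ)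
    exact ⟨h.le, this.symm⟩
  · rintro ⟨h, hr⟩
    refine ⟨lt_of_le_of_ne h ?_, fun z hxz hzy => ?_⟩
    · rintro rfl
      omega
    · have h1 := grade_strictMono (𝕆 := ℕ) hxz
      have h2 := grade_strictMono (𝕆 := ℕ) hzy
      omega

namespace EdgePoset

variable {P : Type*} [PartialOrder P]

/-- The covering relation of `ℰ(P)`: `(x, y) ⋖ (x', y')` if `x ⋖ x'` and `y ⋖ y'`. -/
def Cov (e e' : EdgePoset P) : Prop := e.fst ⋖ e'.fst ∧ e.snd ⋖ e'.snd

theorem fst_le_of_reach {e e' : EdgePoset P} (h : Relation.ReflTransGen Cov e e') :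
    e.fst ≤ e'.fst := by
  induction h with
  | refl => exact le_rfl
  | tail _ hc ih => exact ih.trans hc.1.le

theorem snd_le_of_reach {e e' : EdgePoset P} (h : Relation.ReflTransGen Cov e e') :
    e.snd ≤ e'.snd := by
  induction h with
  | refl => exact le_rfl
  | tail _ hc ih => exact ih.trans hc.2.le

/-- The order of `ℰ(P)` is the reflexive transitive closure of the covering relation `Cov`. -/
instance : PartialOrder (EdgePoset P) where
  le := Relation.ReflTransGen Cov
  le_refl _ := Relation.ReflTransGen.refl
  le_trans _ _ _ := Relation.ReflTransGen.trans
  le_antisymm _ _ h h' := EdgePoset.ext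
    (le_antisymm (fst_le_of_reach h) (fst_le_of_reach h'))
    (le_antisymm (snd_le_of_reach h) (snd_le_of_reach h'))

theorem le_def (e e' : EdgePoset P) : e ≤ e' ↔ Relation.ReflTransGen Cov e e' := Iff.rfl

theorem fst_lt_of_lt {e e' : EdgePoset P} (h : e < e') : e.fst < e'.fst := by
  rcases Relation.ReflTransGen.cases_tail ((le_def _ _).1 h.le) with h1 | ⟨c, h1, h2⟩
  · exact absurd h1.symm h.ne
  · exact (fst_le_of_reach h1).trans_lt h2.1.lt

theorem cov_of_covBy {e e' : EdgePoset P} (h : e ⋖ e') : Cov e e' := by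
  rcases Relation.ReflTransGen.cases_tail ((le_def _ _).1 h.le) with h1 | ⟨c, h1, h2⟩
  · exact absurd h1.symm h.lt.ne
  · have hc : c < e' := lt_of_le_of_ne ((le_def _ _).2 (Relation.ReflTransGen.single h2)) (by
      rintro rfl
      exact lt_irrefl _ h2.1.lt)
    have hec : e = c := by
      by_contra hne
      exact h.2 (lt_of_le_of_ne ((le_def _ _).2 h1) hne) hc
    rw [hec]
    exact h2

/-- `ℰ(P)` is graded by `rk (x, y) = rk x`. -/
instance [GradeOrder ℕ P] : GradeOrder ℕ (EdgePoset P) where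
  grade e := grade ℕ e.fst
  grade_strictMono _ _ h := grade_strictMono (fst_lt_of_lt h)
  covBy_grade _ _ h := (cov_of_covBy h).1.grade ℕ

instance [Finite P] : Finite (EdgePoset P) :=
  Finite.of_injective (fun e : EdgePoset P => (e.fst, e.snd)) fun _ _ h =>
    EdgePoset.ext (congrArg Prod.fst h) (congrArg Prod.snd h)

end EdgePoset

end EdgePoset

section Actions

/-- An action of a group on a graded poset is order-preserving and rank-preserving. -/
class IsGradedAction (G P : Type*) [Group G] [PartialOrder P] [GradeOrder ℕ P] [MulAction G P] :
    Prop where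
  smul_le_smul_iff' (g : G) (x y : P) : g • x ≤ g • y ↔ x ≤ y
  grade_smul' (g : G) (x : P) : grade ℕ (g • x) = grade ℕ x

variable {G P : Type*} [Group G] [PartialOrder P] [GradeOrder ℕ P] [MulAction G P]
  [IsGradedAction G P]

theorem IsGradedAction.smul_covBy (g : G) {x y : P} (h : x ⋖ y) : g • x ⋖ g • y := by
  rw [covBy_iff_le_and_grade] at h ⊢
  rw [IsGradedAction.smul_le_smul_iff', IsGradedAction.grade_smul', IsGradedAction.grade_smul']
  exact h

/-- The induced action on the edge poset: `g • (x, y) = (g • x, g • y)`. -/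
instance : MulAction G (EdgePoset P) where
  smul g e := ⟨g • e.fst, g • e.snd, IsGradedAction.smul_covBy g e.covBy⟩
  one_smul e := EdgePoset.ext (one_smul G e.fst) (one_smul G e.snd)
  mul_smul g h e := EdgePoset.ext (mul_smul g h e.fst) (mul_smul g h e.snd)

theorem EdgePoset.smul_le_smul (g : G) {e e' : EdgePoset P} (h : e ≤ e') : g • e ≤ g • e' := by
  have h' : Relation.ReflTransGen EdgePoset.Cov e e' := h
  change Relation.ReflTransGen EdgePoset.Cov (g • e) (g • e')
  clear h
  induction h' with
  | refl => exact Relation.ReflTransGen.refl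
  | tail _ hc ih =>
    exact ih.tail ⟨IsGradedAction.smul_covBy g hc.1, IsGradedAction.smul_covBy g hc.2⟩

instance : IsGradedAction G (EdgePoset P) where
  smul_le_smul_iff' g e e' := by
    refine ⟨fun h => ?_, EdgePoset.smul_le_smul g⟩
    simpa using EdgePoset.smul_le_smul g⁻¹ h
  grade_smul' g e := IsGradedAction.grade_smul' g e.fst

end Actions

section Quotient

/-- The elements of the quotient poset `P/G`: the orbits of `G` on `P`. -/
def QuotientPoset (G P : Type*) [Group G] [MulAction G P] : Type _ :=
  MulAction.orbitRel.Quotient G P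

namespace QuotientPoset

variable {G P : Type*} [Group G] [MulAction G P]

/-- The orbit of `x`. -/
def mk (x : P) : QuotientPoset G P := Quotient.mk (MulAction.orbitRel G P) x

theorem mk_eq_iff {x y : P} : (mk x : QuotientPoset G P) = mk y ↔ ∃ g : G, g • y = x :=
  Quotient.eq (r := MulAction.orbitRel G P)

theorem mk_surjective : Function.Surjective (mk : P → QuotientPoset G P) :=
  Quotient.mk_surjective

instance [Finite P] : Finite (QuotientPoset G P) :=
  Finite.of_surjective mk mk_surjective

variable [PartialOrder P]

/-- `O ≤ O'` if there are `x ∈ O` and `x' ∈ O'` with `x ≤ x'`. -/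
instance : LE (QuotientPoset G P) where
  le O O' := ∃ x x' : P, mk x = O ∧ mk x' = O' ∧ x ≤ x'

theorem le_def (O O' : QuotientPoset G P) :
    O ≤ O' ↔ ∃ x x' : P, mk x = O ∧ mk x' = O' ∧ x ≤ x' := Iff.rfl

variable [GradeOrder ℕ P] [IsGradedAction G P]

/-- The common rank of the elements of an orbit. -/
def rk (O : QuotientPoset G P) : ℕ :=
  Quotient.lift (s := MulAction.orbitRel G P) (fun x : P => grade ℕ x) (by
    rintro x y ⟨g, rfl⟩
    exact IsGradedAction.grade_smul' g y) O

theorem rk_mk (x : P) : rk (mk x : QuotientPoset G P) = grade ℕ x := rfl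

theorem rk_lt {x x' : P} (h : x ≤ x') (hne : (mk x : QuotientPoset G P) ≠ mk x') :
    rk (mk x : QuotientPoset G P) < rk (mk x' : QuotientPoset G P) := by
  rw [rk_mk, rk_mk]
  refine grade_strictMono (lt_of_le_of_ne h ?_)
  rintro rfl
  exact hne rfl

instance : PartialOrder (QuotientPoset G P) where
  le_refl O := by
    obtain ⟨x, rfl⟩ := mk_surjective O
    exact ⟨x, x, rfl, rfl, le_rfl⟩
  le_trans := by
    rintro _ _ _ ⟨x, y, rfl, rfl, hxy⟩ ⟨y', z, hy, rfl, hyz⟩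
    obtain ⟨g, rfl⟩ := mk_eq_iff.1 hy
    exact ⟨g • x, z, mk_eq_iff.2 ⟨g, rfl⟩, rfl,
      ((IsGradedAction.smul_le_smul_iff' g x y).2 hxy).trans hyz⟩
  le_antisymm := by
    rintro _ _ ⟨x, y, rfl, rfl, hxy⟩ ⟨y', x', hy, hx, hyx⟩
    by_contra hne
    have h1 := rk_lt hxy hne
    have h2 := rk_lt (G := G) hyx (by rw [hy, hx]; exact Ne.symm hne)
    rw [hy, hx] at h2
    omega

/-- `P/G` is graded by the common rank of the elements of each orbit. -/
instance : GradeOrder ℕ (QuotientPoset G P) where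
  grade := rk
  grade_strictMono := by
    intro O O' h
    obtain ⟨x, x', rfl, rfl, hxx⟩ := h.le
    exact rk_lt hxx h.ne
  covBy_grade := by
    intro O O' h
    obtain ⟨x, x', rfl, rfl, hxx⟩ := h.le
    refine CovBy.grade ℕ (a := x) (b := x') ⟨lt_of_le_of_ne hxx ?_, fun z hxz hzx => ?_⟩
    · rintro rfl
      exact h.lt.ne rfl
    · refine h.2 (c := mk z) (lt_of_le_of_ne ⟨x, z, rfl, rfl, hxz.le⟩ fun he => ?_)
        (lt_of_le_of_ne ⟨z, x', rfl, rfl, hzx.le⟩ fun he => ?_)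
      · exact (grade_strictMono (𝕆 := ℕ) hxz).ne (congrArg rk he)
      · exact (grade_strictMono (𝕆 := ℕ) hzx).ne (congrArg rk he)

end QuotientPoset

end Quotient

/-- Every subgroup of `Aut(B_n)` acts on `B_n` by evaluation, preserving order and rank. -/
instance (n : ℕ) (G : Subgroup (Finset (Fin n) ≃o Finset (Fin n))) :
    IsGradedAction G (Finset (Fin n)) where
  smul_le_smul_iff' g x y := (g : Finset (Fin n) ≃o Finset (Fin n)).le_iff_le
  grade_smul' g x := by
    have key : ∀ (f : Finset (Fin n) ≃o Finset (Fin n)) (s : Finset (Fin n)),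
        (f s).card = s.card := by
      intro f s
      induction s using Finset.induction_on with
      | empty => simpa using congrArg Finset.card f.map_bot
      | insert a s ha ih =>
        have hc : f s ⋖ f (insert a s) := (apply_covBy_apply_iff f).2 (Finset.covBy_insert ha)
        have h2 := Nat.covBy_iff_add_one_eq.1 (hc.grade ℕ)
        simp only [Finset.grade_eq] at h2
        rw [Finset.card_insert_of_notMem ha, ← h2, ih]
    exact key g x

/-! The proof uses a linear operator `U` on functions that raises ranks by one, follows the order,
and has `U ^ k` injective on rank `i` whenever `2 * i + k ≤ N`. With rank symmetry this gives
unimodality, and it bounds `dim ker U ^ k` by the total size of `k` consecutive middle ranks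
(`IsLefschetz.finrank_ker_pow_le`). Conversely, a union of `k` antichains has at most `dim ker U ^
k` elements (`ncard_iUnion_antichain_le`), so the poset is strongly Sperner.

On the edges of `B_n`, `n = N + 1`, let `U` sum only over the coverings that add one point to both
ends of an edge, dropping those from `(x, y)` to `(y, z)`. The coverings kept form `n` disjoint
copies of the Hasse diagram of `B_{n-1}`, so `U` and its transpose `D` satisfy `DU - UD = N - 2i` on
rank `i` (`shiftDown_shiftUp_of_mem`). Injectivity follows by positivity of the inner product
(`isLefschetz_shiftUp`).

The choice of coverings is invariant under automorphisms, so `U` acts on `G`-invariant functions,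
which are the functions on the quotient, and injectivity passes to this subspace. Rank symmetry of
the quotient comes from complementation, which commutes with `G`. -/

/-! ### Unions of antichains and kernels of powers -/

section KFamilies

open Module

/-- If `T` maps functions supported on `A ∪ F` to functions supported on `F`, then its kernel has
dimension at least `|A|`. -/
theorem ncard_le_finrank_ker {X : Type*} [Finite X] (T : (X → ℚ) →ₗ[ℚ] (X → ℚ)) (A F : Set X)
    (hd : Disjoint A F)
    (hT : ∀ f : X → ℚ, (∀ x, x ∉ A → x ∉ F → f x = 0) → ∀ x, x ∉ F → T f x = 0) :
    A.ncard ≤ finrank ℚ (LinearMap.ker T) := by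
  classical
  have := Fintype.ofFinite X
  let E : (↥(A ∪ F) → ℚ) →ₗ[ℚ] (X → ℚ) := Function.ExtendByZero.linearMap ℚ Subtype.val
  have hE : Function.Injective E := fun f g hfg => by
    ext x
    have := congrFun hfg x.1
    simpa [E, Subtype.val_injective.extend_apply] using this
  have hE0 : ∀ (f : ↥(A ∪ F) → ℚ) x, x ∉ A → x ∉ F → E f x = 0 := by
    intro f x hA hF
    refine Function.extend_apply' _ _ _ ?_
    rintro ⟨⟨y, hy⟩, rfl⟩
    exact hy.elim hA hF
  -- Rank-nullity from dimension `|A| + |F|` to dimension `|F|`. Reading values on `F` only loses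
  -- nothing, since `T` produces zero elsewhere.
  let R : (↥(A ∪ F) → ℚ) →ₗ[ℚ] (F → ℚ) :=
    (LinearMap.funLeft ℚ ℚ (Subtype.val : F → X)).comp (T.comp E)
  have h1 := R.finrank_range_add_finrank_ker
  have h2 : finrank ℚ (LinearMap.range R) ≤ Fintype.card F := by
    simpa using Submodule.finrank_le (LinearMap.range R)
  have h3 : finrank ℚ (LinearMap.ker R) ≤ finrank ℚ (LinearMap.ker T) := by
    have hker : ∀ f : LinearMap.ker R, E f.1 ∈ LinearMap.ker T := by
      rintro ⟨f, hf⟩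
      rw [LinearMap.mem_ker] at hf ⊢
      ext x
      by_cases hx : x ∈ F
      · exact congrFun hf ⟨x, hx⟩
      · exact hT _ (hE0 f) x hx
    refine LinearMap.finrank_le_finrank_of_injective
      (f := LinearMap.codRestrict (LinearMap.ker T) (E.comp (LinearMap.ker R).subtype) hker) ?_
    intro f g hfg
    exact Subtype.ext (hE (congrArg Subtype.val hfg))
  have h4 : finrank ℚ (↥(A ∪ F) → ℚ) = A.ncard + F.ncard := by
    rw [finrank_fintype_fun_eq_card, ← Nat.card_eq_fintype_card, Nat.card_coe_set_eq,
      Set.ncard_union_eq hd]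
  rw [← Nat.card_eq_fintype_card, Nat.card_coe_set_eq] at h2
  omega

/-- A chain meets each antichain at most once, so chains in the union have at most `k` elements and
the height inside the union serves as `h`. -/
theorem exists_strictMonoOn_of_antichains {P : Type*} [PartialOrder P] {k : ℕ} (A : Fin k → Set P)
    (hA : ∀ j, IsAntichain (· ≤ ·) (A j)) :
    ∃ h : P → ℕ, (∀ a ∈ ⋃ j, A j, h a < k) ∧ StrictMonoOn h (⋃ j, A j) := by
  classical
  have hlen : ∀ s : LTSeries ↥(⋃ j, A j), s.length + 1 ≤ k := by
    intro s
    have hc : ∀ a : ↥(⋃ j, A j), ∃ j, (a : P) ∈ A j := fun a => Set.mem_iUnion.1 a.2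
    choose c hc using hc
    have : Function.Injective fun i => c (s i) := by
      intro i j hij
      have hi := hc (s i)
      have hj := hc (s j)
      rw [show c (s i) = c (s j) from hij] at hi
      by_contra hne
      rcases lt_or_gt_of_ne hne with h | h
      · exact hA _ |>.not_lt hi hj (s.strictMono h)
      · exact hA _ |>.not_lt hj hi (s.strictMono h)
    simpa using Fintype.card_le_of_injective _ this
  have hfin : ∀ a : ↥(⋃ j, A j), Order.height a + 1 ≤ k := by
    intro a
    rcases k with _ | k
    · exact absurd (hlen (RelSeries.singleton _ a)) (by simp)
    · push_cast
      gcongr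
      exact Order.height_le fun s _ => by
        have := hlen s
        exact_mod_cast Nat.le_of_succ_le_succ this
  have htop : ∀ a : ↥(⋃ j, A j), Order.height a < ⊤ := fun a =>
    lt_of_le_of_lt (le_self_add.trans (hfin a)) (ENat.natCast_lt_top k)
  refine ⟨fun a => if ha : a ∈ ⋃ j, A j then (Order.height (⟨a, ha⟩ : ↥(⋃ j, A j))).toNat else 0,
    fun a ha => ?_, fun a ha b hb hab => ?_⟩
  · simp only [ha, dif_pos]
    have h1 := hfin ⟨a, ha⟩
    rw [← ENat.natCast_toNat (htop _).ne] at h1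
    exact_mod_cast h1
  · simp only [ha, hb, dif_pos]
    have h1 := Order.height_strictMono (x := (⟨a, ha⟩ : ↥(⋃ j, A j))) (y := ⟨b, hb⟩) hab (htop _)
    rw [← ENat.natCast_toNat (htop ⟨a, ha⟩).ne, ← ENat.natCast_toNat (htop ⟨b, hb⟩).ne] at h1
    exact_mod_cast h1

/-- `U` acting on sequences `f_0, …, f_{k-1}` of functions by `(U f_j - f_{j+1})_j`. -/
def seqOperator {P : Type*} (U : (P → ℚ) →ₗ[ℚ] (P → ℚ)) (k : ℕ) :
    (P × Fin k → ℚ) →ₗ[ℚ] (P × Fin k → ℚ) where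
  toFun f x := U (fun p => f (p, x.2)) x.1 -
    if h : (x.2 : ℕ) + 1 < k then f (x.1, ⟨x.2 + 1, h⟩) else 0
  map_add' f g := by
    ext x
    have : (fun p => (f + g) (p, x.2)) = (fun p => f (p, x.2)) + fun p => g (p, x.2) := rfl
    rw [this, map_add]
    by_cases h : (x.2 : ℕ) + 1 < k <;> simp [h]; ring
  map_smul' c f := by
    ext x
    have : (fun p => (c • f) (p, x.2)) = c • (fun p => f (p, x.2)) := rfl
    rw [this, map_smul]
    by_cases h : (x.2 : ℕ) + 1 < k <;> simp [h]; ring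

theorem seqOperator_apply {P : Type*} (U : (P → ℚ) →ₗ[ℚ] (P → ℚ)) (k : ℕ) (f : P × Fin k → ℚ)
    (x : P × Fin k) : seqOperator U k f x = U (fun p => f (p, x.2)) x.1 -
    if h : (x.2 : ℕ) + 1 < k then f (x.1, ⟨x.2 + 1, h⟩) else 0 := rfl

theorem pow_apply_of_mem_ker_seqOperator {P : Type*} (U : (P → ℚ) →ₗ[ℚ] (P → ℚ)) (m : ℕ)
    {f : P × Fin (m + 1) → ℚ} (hf : seqOperator U (m + 1) f = 0) (j : ℕ) (hj : j < m + 1) :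
    (fun p => f (p, ⟨j, hj⟩)) = (U ^ j) fun p => f (p, 0) := by
  induction j with
  | zero => rfl
  | succ j ih =>
    rw [pow_succ', Module.End.mul_apply, ← ih (by omega)]
    ext p
    have := congrFun hf (p, ⟨j, by omega⟩)
    rw [seqOperator_apply, dif_pos (by simpa using hj)] at this
    exact (sub_eq_zero.1 this).symm

/-- A sequence in the kernel is `f_j = U ^ j f_0`, hence determined by `f_0`; the last coordinate,
where nothing is subtracted, forces `U ^ (m + 1) f_0 = 0`. -/
theorem finrank_ker_seqOperator_le {P : Type*} [Finite P] (U : (P → ℚ) →ₗ[ℚ] (P → ℚ)) (m : ℕ) :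
    finrank ℚ (LinearMap.ker (seqOperator U (m + 1))) ≤
      finrank ℚ (LinearMap.ker (U ^ (m + 1))) := by
  have := Fintype.ofFinite P
  have hker : ∀ f : LinearMap.ker (seqOperator U (m + 1)),
      LinearMap.funLeft ℚ ℚ (fun p => (p, (0 : Fin (m + 1)))) f.1 ∈
        LinearMap.ker (U ^ (m + 1)) := by
    rintro ⟨f, hf⟩
    rw [LinearMap.mem_ker] at hf ⊢
    change (U ^ (m + 1)) (fun p => f (p, 0)) = 0
    rw [pow_succ', Module.End.mul_apply, ← pow_apply_of_mem_ker_seqOperator U m hf m (by omega)]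
    ext p
    have := congrFun hf (p, ⟨m, by omega⟩)
    rw [seqOperator_apply, dif_neg (by simp)] at this
    simpa using this
  refine LinearMap.finrank_le_finrank_of_injective
    (f := LinearMap.codRestrict (LinearMap.ker (U ^ (m + 1)))
      ((LinearMap.funLeft ℚ ℚ (fun p => (p, (0 : Fin (m + 1))))).comp
        (LinearMap.ker (seqOperator U (m + 1))).subtype) hker) ?_
  rw [← LinearMap.ker_eq_bot, LinearMap.ker_eq_bot']
  rintro ⟨f, hf⟩ h
  have h0 : (fun p => f (p, 0)) = 0 := congrArg Subtype.val h
  ext ⟨p, j, hj⟩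
  have := congrFun (pow_apply_of_mem_ker_seqOperator U m hf j hj) p
  rw [h0, map_zero] at this
  exact this

/-- If `U f q` only depends on the values of `f` strictly below `q`, then a union of `k` antichains
has at most `dim ker U ^ k` elements. -/
theorem ncard_iUnion_antichain_le {P : Type*} [PartialOrder P] [Finite P]
    (U : (P → ℚ) →ₗ[ℚ] (P → ℚ)) (hU : ∀ f q, (∀ p, p < q → f p = 0) → U f q = 0)
    {k : ℕ} (A : Fin k → Set P) (hA : ∀ j, IsAntichain (· ≤ ·) (A j)) :
    (⋃ j, A j).ncard ≤ finrank ℚ (LinearMap.ker (U ^ k)) := by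
  classical
  rcases k with _ | m
  · simp
  obtain ⟨h, hlt, hmono⟩ := exists_strictMonoOn_of_antichains A hA
  set B := ⋃ j, A j
  refine le_trans ?_ (finrank_ker_seqOperator_le U m)
  -- Each `a` in `B` is placed at level `h a`; the bound `h a < m + 1` keeps `Fin.ofNat` from
  -- wrapping around.
  have hB : B.ncard ≤ {x : P × Fin (m + 1) | x.1 ∈ B ∧ (x.2 : ℕ) = h x.1}.ncard := by
    refine Set.ncard_le_ncard_of_injOn (fun a => (a, Fin.ofNat (m + 1) (h a))) ?_ ?_ (Set.toFinite _)
    · intro a ha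
      exact ⟨ha, Nat.mod_eq_of_lt (hlt a ha)⟩
    · intro a _ b _ hab
      exact congrArg Prod.fst hab
  -- Off `F`, a pair `(q, j)` has `q ≤ a` and `h a ≤ j` for some `a` in `B`. The values entering the
  -- operator there sit at `(p, j)` with `p < q`, or at `(q, j + 1)`. These are again off `F`, and
  -- they are not marked, because `h p < h a ≤ j` and `h q ≤ h a < j + 1` for points of `B`.
  refine hB.trans (ncard_le_finrank_ker _ _
    {x : P × Fin (m + 1) | ¬ ∃ a ∈ B, x.1 ≤ a ∧ h a ≤ x.2} ?_ ?_)
  · rw [Set.disjoint_left]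
    rintro ⟨a, j⟩ ⟨ha, hj⟩ hn
    exact hn ⟨a, ha, le_rfl, hj.ge⟩
  · rintro f hf ⟨q, j⟩ hq
    simp only [Set.mem_ofPred_eq, not_not] at hq hf
    obtain ⟨a, ha, hqa, hj⟩ := hq
    rw [seqOperator_apply]
    have h1 : U (fun p => f (p, j)) q = 0 := by
      refine hU _ _ fun p hp => hf _ ?_ ⟨a, ha, hp.le.trans hqa, hj⟩
      rintro ⟨hpB, hpj⟩
      have : h p < h a := hmono hpB ha (hp.trans_le hqa)
      change (j : ℕ) = h p at hpj
      omega
    have h2 : ∀ hh : (j : ℕ) + 1 < m + 1, f (q, ⟨j + 1, hh⟩) = 0 := by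
      intro hh
      refine hf _ ?_ ⟨a, ha, hqa, by simp only; omega⟩
      rintro ⟨hqB, hqj⟩
      have : h q ≤ h a := hmono.monotoneOn hqB ha hqa
      change (j : ℕ) + 1 = h q at hqj
      omega
    simp only [h1]
    split_ifs with hh
    · rw [h2 hh, sub_zero]
    · simp

end KFamilies

/-! ### Consequences of the hard Lefschetz property -/

section Lefschetz

open Module

variable {P : Type*} [PartialOrder P] [GradeOrder ℕ P]

/-- Functions supported on the elements of rank `i`. -/
def rankSpace (P : Type*) [PartialOrder P] [GradeOrder ℕ P] (i : ℕ) : Submodule ℚ (P → ℚ) where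
  carrier := {f | ∀ p, grade ℕ p ≠ i → f p = 0}
  zero_mem' _ _ := rfl
  add_mem' hf hg p hp := by simp [hf p hp, hg p hp]
  smul_mem' c f hf p hp := by simp [hf p hp]

theorem finrank_rankSpace [Finite P] (i : ℕ) : finrank ℚ (rankSpace P i) = rankNumber P i := by
  classical
  have := Fintype.ofFinite P
  let R : rankSpace P i →ₗ[ℚ] ({p : P | grade ℕ p = i} → ℚ) :=
    (LinearMap.funLeft ℚ ℚ Subtype.val).comp (rankSpace P i).subtype
  have hR : Function.Bijective R := by
    constructor
    · rintro ⟨f, hf⟩ ⟨g, hg⟩ h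
      ext p
      by_cases hp : grade ℕ p = i
      · exact congrFun h ⟨p, hp⟩
      · exact (hf p hp).trans (hg p hp).symm
    · intro f
      refine ⟨⟨fun p => if hp : grade ℕ p = i then f ⟨p, hp⟩ else 0, fun p hp => dif_neg hp⟩, ?_⟩
      ext ⟨p, hp⟩
      exact dif_pos hp
  rw [(LinearEquiv.ofBijective R hR).finrank_eq, finrank_fintype_fun_eq_card,
    ← Nat.card_eq_fintype_card, Nat.card_coe_set_eq, rankNumber]

/-- `U` raises ranks: `U f q` only depends on the values of `f` at elements `p < q` of rank one
less. -/
def IsRankRaising (U : (P → ℚ) →ₗ[ℚ] (P → ℚ)) : Prop :=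
  ∀ f q, (∀ p, p < q → grade ℕ p + 1 = grade ℕ q → f p = 0) → U f q = 0

/-- The injectivity half of the hard Lefschetz property of rank `N`. -/
def IsLefschetz (U : (P → ℚ) →ₗ[ℚ] (P → ℚ)) (N : ℕ) : Prop :=
  ∀ i k, 2 * i + k ≤ N → ∀ f ∈ rankSpace P i, (U ^ k) f = 0 → f = 0

variable {U : (P → ℚ) →ₗ[ℚ] (P → ℚ)} {N : ℕ}

theorem IsRankRaising.pow_eq_zero (hU : IsRankRaising U) (k : ℕ) (f : P → ℚ) (q : P)
    (h : ∀ p, grade ℕ p + k = grade ℕ q → f p = 0) : (U ^ k) f q = 0 := by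
  induction k generalizing q with
  | zero => exact h q rfl
  | succ k ih =>
    rw [pow_succ', Module.End.mul_apply]
    exact hU _ _ fun p _ hp => ih p fun p' hp' => h p' (by omega)

theorem IsRankRaising.pow_mem (hU : IsRankRaising U) (k : ℕ) {i : ℕ} {f : P → ℚ}
    (hf : f ∈ rankSpace P i) : (U ^ k) f ∈ rankSpace P (i + k) := fun q hq =>
  hU.pow_eq_zero k f q fun p hp => hf p (by omega)

theorem IsLefschetz.rankNumber_le [Finite P] (hL : IsLefschetz U N) (hU : IsRankRaising U)
    {i k : ℕ} (h : 2 * i + k ≤ N) : rankNumber P i ≤ rankNumber P (i + k) := by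
  have := Fintype.ofFinite P
  rw [← finrank_rankSpace, ← finrank_rankSpace]
  refine LinearMap.finrank_le_finrank_of_injective
    (f := (U ^ k).restrict fun f hf => hU.pow_mem k hf) ?_
  rw [← LinearMap.ker_eq_bot, LinearMap.ker_eq_bot']
  rintro ⟨f, hf⟩ h0
  exact Subtype.ext (hL i k h f hf (congrArg Subtype.val h0))

/-- The rank `j` opposite to `i + k` satisfies `j ≤ i` and has the same dimension as rank `i + k`.
The injective power of `U` from `j` to `i + k` is therefore bijective, and it factors through rank
`i`. -/
theorem IsLefschetz.surjective [Finite P] (hL : IsLefschetz U N) (hU : IsRankRaising U)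
    (hsym : IsRankSymmetric P N) {i k : ℕ} (h : N ≤ 2 * i + k) (hi : i + k ≤ N) {f : P → ℚ}
    (hf : f ∈ rankSpace P (i + k)) : ∃ g ∈ rankSpace P i, (U ^ k) g = f := by
  have := Fintype.ofFinite P
  obtain ⟨m, hm⟩ : ∃ m, m + (N - (i + k)) = i := ⟨i - (N - (i + k)), by omega⟩
  set j := N - (i + k)
  have hjk : j + (m + k) = i + k := by omega
  let R : rankSpace P j →ₗ[ℚ] rankSpace P (i + k) :=
    (U ^ (m + k)).restrict fun f hf => hjk ▸ hU.pow_mem (m + k) hf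
  have hR : Function.Injective R := by
    rw [← LinearMap.ker_eq_bot, LinearMap.ker_eq_bot']
    rintro ⟨f, hf⟩ h0
    exact Subtype.ext (hL j (m + k) (by omega) f hf (congrArg Subtype.val h0))
  have hdim : finrank ℚ (rankSpace P j) = finrank ℚ (rankSpace P (i + k)) := by
    rw [finrank_rankSpace, finrank_rankSpace, hsym _ hi]
  obtain ⟨⟨g, hg⟩, hgf⟩ :=
    (LinearMap.injective_iff_surjective_of_finrank_eq_finrank hdim).1 hR ⟨f, hf⟩
  refine ⟨(U ^ m) g, ?_, ?_⟩
  · have := hU.pow_mem m hg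
    rwa [show j + m = i by omega] at this
  · rw [← Module.End.mul_apply, ← pow_add, add_comm k m]
    exact congrArg Subtype.val hgf

theorem IsLefschetz.isRankUnimodal [Finite P] (hL : IsLefschetz U N) (hU : IsRankRaising U)
    (hsym : IsRankSymmetric P N) : IsRankUnimodal P N := by
  refine ⟨N / 2, by omega, fun i hi => hL.rankNumber_le hU (by omega), fun i hi hiN => ?_⟩
  rw [hsym i hiN.le, hsym (i + 1) hiN, show N - i = N - (i + 1) + 1 by omega]
  exact hL.rankNumber_le hU (by omega)

/-- `U ^ k` sends distinct ranks to distinct ranks, so the rank components of a kernel element lie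
in the kernel separately. -/
theorem IsLefschetz.pow_eq_zero (hL : IsLefschetz U N) (hU : IsRankRaising U) {k : ℕ} {f : P → ℚ}
    (hf : (U ^ k) f = 0) {p : P} (hp : 2 * grade ℕ p + k ≤ N) : f p = 0 := by
  classical
  let g : P → ℚ := fun q => if grade ℕ q = grade ℕ p then f q else 0
  have hg : g ∈ rankSpace P (grade ℕ p) := fun q hq => if_neg hq
  have h0 : (U ^ k) g = 0 := by
    ext q
    by_cases hq : grade ℕ q = grade ℕ p + k
    · have : (U ^ k) (g - f) q = 0 := hU.pow_eq_zero k _ q fun p' hp' => by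
        simp [g, show grade ℕ p' = grade ℕ p by omega]
      rwa [map_sub, hf, sub_zero] at this
    · exact hU.pow_mem k hg q hq
  have := congrFun (hL _ k hp g hg h0) p
  simpa [g] using this

/-- The kernel of `U ^ k` has at most the dimension of the `k` middle ranks together. -/
theorem IsLefschetz.finrank_ker_pow_le [Finite P] (hL : IsLefschetz U N) (hU : IsRankRaising U)
    (hN : ∀ p : P, grade ℕ p ≤ N) (hsym : IsRankSymmetric P N) (k : ℕ) :
    finrank ℚ (LinearMap.ker (U ^ k)) ≤
      ∑ i ∈ Finset.Ico ((N + 2 - k) / 2) ((N + 2 - k) / 2 + k), rankNumber P i := by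
  classical
  have := Fintype.ofFinite P
  -- The threshold between the two regimes: `2 * i + k ≤ N` for `i < m`, so `U ^ k` is injective
  -- there, and `N ≤ 2 * i + k` for `i ≥ m`, so it is onto from there. For `k > N + 2` truncation
  -- gives `m = 0` and the first regime is empty.
  set m := (N + 2 - k) / 2 with hm
  let C := {p : P // m ≤ grade ℕ p}
  let D := {p : P // m + k ≤ grade ℕ p}
  let E : (C → ℚ) →ₗ[ℚ] (P → ℚ) := Function.ExtendByZero.linearMap ℚ Subtype.val
  have hE : ∀ (f : P → ℚ), (∀ p, ¬ m ≤ grade ℕ p → f p = 0) → E (fun p => f p.1) = f := by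
    intro f hf
    ext p
    by_cases hp : m ≤ grade ℕ p
    · exact Subtype.val_injective.extend_apply (fun p : C => f p.1) 0 ⟨p, hp⟩
    · rw [hf p hp]
      change Function.extend (Subtype.val : C → P) (fun p => f p.1) (0 : P → ℚ) p = 0
      refine Function.extend_apply' _ _ _ ?_
      rintro ⟨⟨y, hy⟩, rfl⟩
      exact hp hy
  -- `R` maps onto the functions on `D`, so its kernel has dimension `|C| - |D|`; it contains a copy
  -- of `ker U ^ k`, whose elements vanish below rank `m`.
  let R : (C → ℚ) →ₗ[ℚ] (D → ℚ) :=
    (LinearMap.funLeft ℚ ℚ (Subtype.val : D → P)).comp ((U ^ k).comp E)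
  have hRsurj : Function.Surjective R := by
    rw [← LinearMap.range_eq_top, eq_top_iff, ← (Pi.basisFun ℚ D).span_eq, Submodule.span_le]
    rintro _ ⟨⟨q, hq⟩, rfl⟩
    obtain ⟨i, hi⟩ : ∃ i, i + k = grade ℕ q := ⟨grade ℕ q - k, by omega⟩
    have hqN := hN q
    obtain ⟨g, hg, hgq⟩ := hL.surjective hU hsym (i := i) (k := k) (by omega) (by omega)
      (f := Pi.single q 1) (fun p hp => Pi.single_eq_of_ne (fun h => hp (by rw [h, hi])) _)
    refine ⟨fun p => g p.1, ?_⟩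
    ext ⟨p, hp⟩
    change (U ^ k) (E fun p => g p.1) p = _
    rw [hE g (fun p hp => hg p (by omega)), hgq, Pi.basisFun_apply]
    simp only [Pi.single_apply]
    exact if_congr Subtype.mk_eq_mk.symm rfl rfl
  have h1 := R.finrank_range_add_finrank_ker
  rw [LinearMap.range_eq_top.2 hRsurj, finrank_top, finrank_fintype_fun_eq_card,
    finrank_fintype_fun_eq_card] at h1
  have hzero : ∀ f ∈ LinearMap.ker (U ^ k), ∀ p, ¬ m ≤ grade ℕ p → f p = 0 := fun f hf p hp =>
    hL.pow_eq_zero hU hf (by omega)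
  have hker : ∀ f : LinearMap.ker (U ^ k),
      LinearMap.funLeft ℚ ℚ (Subtype.val : C → P) f.1 ∈ LinearMap.ker R := by
    rintro ⟨f, hf⟩
    rw [LinearMap.mem_ker]
    ext p
    change (U ^ k) (E fun p => f p.1) p.1 = 0
    rw [hE f (hzero f hf), hf, Pi.zero_apply]
  have h2 : finrank ℚ (LinearMap.ker (U ^ k)) ≤ finrank ℚ (LinearMap.ker R) := by
    refine LinearMap.finrank_le_finrank_of_injective
      (f := LinearMap.codRestrict (LinearMap.ker R)
        ((LinearMap.funLeft ℚ ℚ (Subtype.val : C → P)).comp (LinearMap.ker (U ^ k)).subtype)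
        hker) ?_
    rintro ⟨f, hf⟩ ⟨g, hg⟩ h
    have h' : (fun p : C => f p.1) = fun p => g p.1 := congrArg Subtype.val h
    ext p
    change f p = g p
    rw [← hE f (hzero f hf), ← hE g (hzero g hg), h']
  have h3 : Fintype.card C = Fintype.card D +
      ∑ i ∈ Finset.Ico m (m + k), rankNumber P i := by
    have hrank : ∀ i, rankNumber P i =
        ((Finset.univ : Finset P).filter fun p => grade ℕ p = i).card := fun i => by
      rw [rankNumber, ← Set.ncard_coe_finset]
      simp
    simp only [hrank, C, D, Fintype.card_subtype]
    rw [← Finset.card_biUnion, ← Finset.card_union_of_disjoint]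
    · congr 1
      ext p
      simp only [Finset.mem_filter, Finset.mem_union, Finset.mem_biUnion, Finset.mem_univ,
        true_and, Finset.mem_Ico]
      constructor
      · intro h
        by_cases h' : m + k ≤ grade ℕ p
        · exact Or.inl h'
        · exact Or.inr ⟨_, ⟨h, by omega⟩, rfl⟩
      · rintro (h | ⟨i, ⟨h, -⟩, rfl⟩)
        · omega
        · exact h
    · rw [Finset.disjoint_left]
      intro p hp hp'
      simp only [Finset.mem_filter, Finset.mem_biUnion, Finset.mem_univ,
        true_and, Finset.mem_Ico] at hp hp'
      obtain ⟨i, ⟨-, h⟩, rfl⟩ := hp'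
      omega
    · intro i _ j _ hij
      exact Finset.disjoint_filter.2 fun p _ hi hj => hij (hi.symm.trans hj)
  omega

/-- A finite graded poset with a rank-raising operator satisfying the hard Lefschetz property is
strongly Sperner. -/
theorem IsLefschetz.isStronglySperner [Finite P] (hL : IsLefschetz U N) (hU : IsRankRaising U)
    (hN : ∀ p : P, grade ℕ p ≤ N) (hsym : IsRankSymmetric P N) : IsStronglySperner P :=
  fun k A hA _ => ⟨_, by simp, (ncard_iUnion_antichain_le U
    (fun f q h => hU f q fun p hp _ => h p hp) A hA).trans (hL.finrank_ker_pow_le hU hN hsym k)⟩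

end Lefschetz

/-! ### Shift operators on edges -/

namespace EdgePoset

section Shift

variable {P : Type*} [PartialOrder P]

/-- The coverings of the edge poset of a Boolean algebra that move both ends of an edge in the same
direction. -/
def IsShift (e e' : EdgePoset P) : Prop := e.fst ⋖ e'.fst ∧ e.snd ⋖ e'.snd ∧ e.snd ≠ e'.fst

theorem IsShift.le {e e' : EdgePoset P} (h : IsShift e e') : e ≤ e' :=
  (le_def _ _).2 (Relation.ReflTransGen.single ⟨h.1, h.2.1⟩)

variable [Fintype (EdgePoset P)]

open Classical in
/-- The operator on functions on edges that sums over the shifts below an edge. -/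
noncomputable def shiftUp (P : Type*) [PartialOrder P] [Fintype (EdgePoset P)] :
    (EdgePoset P → ℚ) →ₗ[ℚ] (EdgePoset P → ℚ) where
  toFun f e := ∑ e' with IsShift e' e, f e'
  map_add' f g := by ext e; simp [Finset.sum_add_distrib]
  map_smul' c f := by ext e; simp [Finset.mul_sum]

open Classical in
/-- The operator on functions on edges that sums over the shifts above an edge. -/
noncomputable def shiftDown (P : Type*) [PartialOrder P] [Fintype (EdgePoset P)] :
    (EdgePoset P → ℚ) →ₗ[ℚ] (EdgePoset P → ℚ) where
  toFun f e := ∑ e' with IsShift e e', f e'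
  map_add' f g := by ext e; simp [Finset.sum_add_distrib]
  map_smul' c f := by ext e; simp [Finset.mul_sum]

open Classical in
theorem shiftUp_apply (f : EdgePoset P → ℚ) (e : EdgePoset P) :
    shiftUp P f e = ∑ e' with IsShift e' e, f e' := rfl

open Classical in
theorem shiftDown_apply (f : EdgePoset P → ℚ) (e : EdgePoset P) :
    shiftDown P f e = ∑ e' with IsShift e e', f e' := rfl

/-- The two operators are transposes of each other, which later turns `⟨UDf, f⟩` into a sum of
squares. -/
theorem sum_shiftUp_mul (f g : EdgePoset P → ℚ) :
    ∑ e, shiftUp P f e * g e = ∑ e, f e * shiftDown P g e := by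
  classical
  simp only [shiftUp_apply, shiftDown_apply, Finset.sum_mul, Finset.mul_sum, Finset.sum_filter]
  rw [Finset.sum_comm]
  refine Finset.sum_congr rfl fun e _ => Finset.sum_congr rfl fun e' _ => ?_
  split_ifs <;> simp

theorem isRankRaising_shiftUp [GradeOrder ℕ P] : IsRankRaising (shiftUp P) := by
  classical
  intro f e h
  rw [shiftUp_apply]
  refine Finset.sum_eq_zero fun e' he' => ?_
  have hs : IsShift e' e := (Finset.mem_filter.1 he').2
  have hg : grade ℕ e' + 1 = grade ℕ e := Nat.covBy_iff_add_one_eq.1 (hs.1.grade ℕ)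
  refine h e' (lt_of_le_of_ne hs.le ?_) hg
  rintro rfl
  omega

theorem shiftDown_mem_rankSpace [GradeOrder ℕ P] {i : ℕ} {f : EdgePoset P → ℚ}
    (hf : f ∈ rankSpace (EdgePoset P) (i + 1)) : shiftDown P f ∈ rankSpace (EdgePoset P) i := by
  classical
  intro e he
  rw [shiftDown_apply]
  refine Finset.sum_eq_zero fun e' he' => hf e' ?_
  have hs : IsShift e e' := (Finset.mem_filter.1 he').2
  have hg : grade ℕ e + 1 = grade ℕ e' := Nat.covBy_iff_add_one_eq.1 (hs.1.grade ℕ)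
  omega

end Shift

/-! ### Shifts in a Boolean algebra as adding or removing a point -/

section Boolean

variable {α : Type*} [DecidableEq α]

theorem exists_snd_eq_insert (e : EdgePoset (Finset α)) :
    ∃ a, a ∉ e.fst ∧ e.snd = insert a e.fst := by
  obtain ⟨a, ha, h⟩ := Finset.covBy_iff_exists_insert.1 e.covBy
  exact ⟨a, ha, h.symm⟩

omit [DecidableEq α] in
theorem fst_subset_snd (e : EdgePoset (Finset α)) : e.fst ⊆ e.snd := e.covBy.le

/-- Remove `b` from both ends of an edge, for `b` in the lower end. -/
def eraseBoth (e : EdgePoset (Finset α)) (b : α) (hb : b ∈ e.fst) : EdgePoset (Finset α) where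
  fst := e.fst.erase b
  snd := e.snd.erase b
  covBy := by
    obtain ⟨a, ha, h⟩ := exists_snd_eq_insert e
    have hab : a ≠ b := by
      rintro rfl
      exact ha hb
    rw [h, Finset.erase_insert_of_ne hab]
    exact Finset.covBy_insert fun h' => ha (Finset.mem_of_mem_erase h')

/-- Add `b` to both ends of an edge, for `b` outside the upper end. -/
def insertBoth (e : EdgePoset (Finset α)) (b : α) (hb : b ∉ e.snd) : EdgePoset (Finset α) where
  fst := insert b e.fst
  snd := insert b e.snd
  covBy := by
    obtain ⟨a, ha, h⟩ := exists_snd_eq_insert e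
    have hab : a ≠ b := by
      rintro rfl
      exact hb (h ▸ Finset.mem_insert_self _ _)
    rw [h, Finset.insert_comm]
    exact Finset.covBy_insert fun h' => ha ((Finset.mem_insert.1 h').resolve_left hab)

theorem isShift_insertBoth (e : EdgePoset (Finset α)) (b : α) (hb : b ∉ e.snd) :
    IsShift e (e.insertBoth b hb) :=
  ⟨Finset.covBy_insert fun h => hb (e.fst_subset_snd h), Finset.covBy_insert hb,
    fun h => hb (h ▸ Finset.mem_insert_self _ _)⟩

theorem insertBoth_eraseBoth (e : EdgePoset (Finset α)) (b : α) (hb : b ∈ e.fst)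
    (hb' : b ∉ (e.eraseBoth b hb).snd) : (e.eraseBoth b hb).insertBoth b hb' = e :=
  EdgePoset.ext (Finset.insert_erase hb) (Finset.insert_erase (e.fst_subset_snd hb))

theorem eraseBoth_insertBoth (e : EdgePoset (Finset α)) (b : α) (hb : b ∉ e.snd)
    (hb' : b ∈ (e.insertBoth b hb).fst) : (e.insertBoth b hb).eraseBoth b hb' = e :=
  EdgePoset.ext (Finset.erase_insert fun h => hb (e.fst_subset_snd h)) (Finset.erase_insert hb)

theorem isShift_eraseBoth (e : EdgePoset (Finset α)) (b : α) (hb : b ∈ e.fst) :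
    IsShift (e.eraseBoth b hb) e := by
  have hb' : b ∉ (e.eraseBoth b hb).snd := Finset.notMem_erase _ _
  have h := isShift_insertBoth (e.eraseBoth b hb) b hb'
  rwa [insertBoth_eraseBoth] at h

/-- If the point added to the lower end were the one separating the two ends of `e`, then `e.snd =
e'.fst`, which a shift excludes. So it lies outside `e.snd`, and the upper end must gain the same
point. -/
theorem IsShift.exists_insertBoth {e e' : EdgePoset (Finset α)} (h : IsShift e e') :
    ∃ b, ∃ hb : b ∉ e.snd, e.insertBoth b hb = e' := by
  obtain ⟨h1, h2, h3⟩ := h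
  obtain ⟨b, hb, hb'⟩ := Finset.covBy_iff_exists_insert.1 h1
  obtain ⟨c, hc, hc'⟩ := Finset.covBy_iff_exists_insert.1 h2
  obtain ⟨a, ha, ha'⟩ := exists_snd_eq_insert e
  have hbs : b ∉ e.snd := by
    intro hmem
    rw [ha', Finset.mem_insert] at hmem
    rcases hmem with rfl | hmem
    · exact h3 (ha'.trans hb')
    · exact hb hmem
  refine ⟨b, hbs, EdgePoset.ext hb' ?_⟩
  have : b ∈ insert c e.snd := by
    rw [hc']
    exact e'.fst_subset_snd (hb' ▸ Finset.mem_insert_self _ _)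
  obtain rfl := (Finset.mem_insert.1 this).resolve_right hbs
  exact hc'

theorem IsShift.exists_eraseBoth {e e' : EdgePoset (Finset α)} (h : IsShift e' e) :
    ∃ b, ∃ hb : b ∈ e.fst, e.eraseBoth b hb = e' := by
  obtain ⟨b, hb, rfl⟩ := h.exists_insertBoth
  exact ⟨b, Finset.mem_insert_self _ _, eraseBoth_insertBoth _ _ _ _⟩

variable [Fintype (EdgePoset (Finset α))]

theorem shiftUp_eq_sum (f : EdgePoset (Finset α) → ℚ) (e : EdgePoset (Finset α)) :
    shiftUp _ f e = ∑ b ∈ e.fst.attach, f (e.eraseBoth b b.2) := by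
  classical
  rw [shiftUp_apply]
  symm
  refine Finset.sum_bij (fun b _ => e.eraseBoth b b.2) ?_ ?_ ?_ fun _ _ => rfl
  · exact fun b _ => Finset.mem_filter.2 ⟨Finset.mem_univ _, isShift_eraseBoth _ _ _⟩
  · exact fun b _ c _ h => Subtype.ext (Finset.erase_injOn _ b.2 c.2 (congrArg EdgePoset.fst h))
  · intro e' he'
    obtain ⟨b, hb, h⟩ := (Finset.mem_filter.1 he').2.exists_eraseBoth
    exact ⟨⟨b, hb⟩, Finset.mem_attach _ _, h⟩

theorem shiftDown_eq_sum [Fintype α] (f : EdgePoset (Finset α) → ℚ) (e : EdgePoset (Finset α)) :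
    shiftDown _ f e =
      ∑ b ∈ e.sndᶜ.attach, f (e.insertBoth b (Finset.mem_compl.1 b.2)) := by
  classical
  rw [shiftDown_apply]
  symm
  refine Finset.sum_bij (fun b _ => e.insertBoth b (Finset.mem_compl.1 b.2)) ?_ ?_ ?_
    fun _ _ => rfl
  · exact fun b _ => Finset.mem_filter.2 ⟨Finset.mem_univ _, isShift_insertBoth _ _ _⟩
  · intro b _ c _ h
    have h1 : insert (b : α) e.snd = insert (c : α) e.snd := congrArg EdgePoset.snd h
    have h2 : (b : α) ∈ insert (c : α) e.snd := h1 ▸ Finset.mem_insert_self _ _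
    exact Subtype.ext ((Finset.mem_insert.1 h2).resolve_right (Finset.mem_compl.1 b.2))
  · intro e' he'
    obtain ⟨b, hb, h⟩ := (Finset.mem_filter.1 he').2.exists_insertBoth
    exact ⟨⟨b, Finset.mem_compl.2 hb⟩, Finset.mem_attach _ _, h⟩

end Boolean

end EdgePoset

/-! ### The commutation relation and hard Lefschetz for edges -/

namespace EdgePoset

variable {α : Type*} [DecidableEq α]

open Classical in
/-- Extension of a function on edges to all pairs of sets by zero. -/
noncomputable def extendPairs (f : EdgePoset (Finset α) → ℚ) (x y : Finset α) : ℚ :=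
  if h : x ⋖ y then f ⟨x, y, h⟩ else 0

omit [DecidableEq α] in
theorem extendPairs_fst_snd (f : EdgePoset (Finset α) → ℚ) (e : EdgePoset (Finset α)) :
    extendPairs f e.fst e.snd = f e := dif_pos e.covBy

variable [Fintype (EdgePoset (Finset α))]

theorem shiftUp_eq_sum_extendPairs (f : EdgePoset (Finset α) → ℚ) (e : EdgePoset (Finset α)) :
    shiftUp _ f e = ∑ b ∈ e.fst, extendPairs f (e.fst.erase b) (e.snd.erase b) := by
  rw [shiftUp_eq_sum, ← Finset.sum_attach e.fst]
  exact Finset.sum_congr rfl fun b _ => (extendPairs_fst_snd f (e.eraseBoth b b.2)).symm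

variable [Fintype α]

theorem shiftDown_eq_sum_extendPairs (f : EdgePoset (Finset α) → ℚ) (e : EdgePoset (Finset α)) :
    shiftDown _ f e = ∑ b ∈ e.sndᶜ, extendPairs f (insert b e.fst) (insert b e.snd) := by
  rw [shiftDown_eq_sum, ← Finset.sum_attach e.sndᶜ]
  exact Finset.sum_congr rfl fun b _ =>
    (extendPairs_fst_snd f (e.insertBoth b (Finset.mem_compl.1 b.2))).symm

/-- Adding `b` and removing `c ≠ b` commute, so these terms cancel. Adding and removing the same
point returns `f e`: once for each point outside `e.snd` on the left, and once for each point of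
`e.fst` on the right. -/
theorem shiftDown_shiftUp (f : EdgePoset (Finset α) → ℚ) (e : EdgePoset (Finset α)) :
    shiftDown _ (shiftUp _ f) e =
      shiftUp _ (shiftDown _ f) e + ((e.sndᶜ.card : ℚ) - e.fst.card) * f e := by
  have h1 : shiftDown _ (shiftUp _ f) e = ∑ b ∈ e.sndᶜ, ∑ c ∈ insert b e.fst,
      extendPairs f ((insert b e.fst).erase c) ((insert b e.snd).erase c) := by
    rw [shiftDown_eq_sum, ← Finset.sum_attach e.sndᶜ]
    exact Finset.sum_congr rfl fun b _ => shiftUp_eq_sum_extendPairs f _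
  have h2 : shiftUp _ (shiftDown _ f) e = ∑ c ∈ e.fst, ∑ b ∈ (e.snd.erase c)ᶜ,
      extendPairs f (insert b (e.fst.erase c)) (insert b (e.snd.erase c)) := by
    rw [shiftUp_eq_sum, ← Finset.sum_attach e.fst]
    exact Finset.sum_congr rfl fun b _ => shiftDown_eq_sum_extendPairs f _
  have h3 : ∀ b ∈ e.sndᶜ, ∑ c ∈ insert b e.fst,
      extendPairs f ((insert b e.fst).erase c) ((insert b e.snd).erase c) = f e +
        ∑ c ∈ e.fst, extendPairs f (insert b (e.fst.erase c)) (insert b (e.snd.erase c)) := by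
    intro b hb
    have hbs := Finset.mem_compl.1 hb
    have hbf : b ∉ e.fst := fun h => hbs (e.fst_subset_snd h)
    rw [Finset.sum_insert hbf, Finset.erase_insert hbf, Finset.erase_insert hbs,
      extendPairs_fst_snd]
    congr 1
    refine Finset.sum_congr rfl fun c hc => ?_
    have hbc : b ≠ c := fun h => hbf (h ▸ hc)
    rw [Finset.erase_insert_of_ne hbc, Finset.erase_insert_of_ne hbc]
  have h4 : ∀ c ∈ e.fst, ∑ b ∈ (e.snd.erase c)ᶜ,
      extendPairs f (insert b (e.fst.erase c)) (insert b (e.snd.erase c)) = f e +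
        ∑ b ∈ e.sndᶜ, extendPairs f (insert b (e.fst.erase c)) (insert b (e.snd.erase c)) := by
    intro c hc
    have hcs := e.fst_subset_snd hc
    rw [Finset.compl_erase, Finset.sum_insert (by simpa using hcs), Finset.insert_erase hc,
      Finset.insert_erase hcs, extendPairs_fst_snd]
  rw [h1, h2, Finset.sum_congr rfl h3, Finset.sum_congr rfl h4, Finset.sum_add_distrib,
    Finset.sum_add_distrib, Finset.sum_comm (s := e.sndᶜ)]
  simp only [Finset.sum_const, nsmul_eq_mul]
  ring

omit [Fintype (EdgePoset (Finset α))] in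
theorem card_compl_snd_add_grade {N : ℕ} (hα : Fintype.card α = N + 1)
    (e : EdgePoset (Finset α)) : e.sndᶜ.card + grade ℕ e = N := by
  obtain ⟨a, ha, h⟩ := exists_snd_eq_insert e
  have h1 := Finset.card_compl_add_card e.snd
  have h2 : e.snd.card = e.fst.card + 1 := by rw [h, Finset.card_insert_of_notMem ha]
  have h3 : grade ℕ e = e.fst.card := rfl
  omega

theorem shiftDown_shiftUp_of_mem {N i : ℕ} (hα : Fintype.card α = N + 1)
    {f : EdgePoset (Finset α) → ℚ} (hf : f ∈ rankSpace (EdgePoset (Finset α)) i) :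
    shiftDown _ (shiftUp _ f) = shiftUp _ (shiftDown _ f) + ((N : ℚ) - 2 * i) • f := by
  ext e
  rw [shiftDown_shiftUp, Pi.add_apply, Pi.smul_apply, smul_eq_mul]
  by_cases he : grade ℕ e = i
  · have h1 : (e.sndᶜ.card : ℚ) + e.fst.card = N := by
      exact_mod_cast card_compl_snd_add_grade hα e
    have h2 : (e.fst.card : ℚ) = i := by exact_mod_cast he
    rw [show (e.sndᶜ.card : ℚ) - e.fst.card = N - 2 * i by linarith]
  · rw [hf e he, mul_zero, mul_zero]

/-- Moving `D` past one factor `U` at a time collects `N - 2 * (i + j)` for `j = 0, …, k`; the sum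
is the stated coefficient. -/
theorem shiftDown_shiftUp_pow {N i : ℕ} (hα : Fintype.card α = N + 1)
    {f : EdgePoset (Finset α) → ℚ} (hf : f ∈ rankSpace (EdgePoset (Finset α)) i) (k : ℕ) :
    shiftDown _ ((shiftUp _ ^ (k + 1)) f) = (shiftUp _ ^ (k + 1)) (shiftDown _ f) +
      (((k : ℚ) + 1) * (N - 2 * i - k)) • (shiftUp _ ^ k) f := by
  induction k with
  | zero => simpa using shiftDown_shiftUp_of_mem hα hf
  | succ k ih =>
    rw [pow_succ' _ (k + 1), Module.End.mul_apply, Module.End.mul_apply,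
      shiftDown_shiftUp_of_mem hα (isRankRaising_shiftUp.pow_mem (k + 1) hf), ih, map_add,
      map_smul, ← Module.End.mul_apply (shiftUp (Finset α)) (shiftUp (Finset α) ^ k),
      ← pow_succ', add_assoc, ← add_smul]
    congr 2
    push_cast
    ring

/-- `shiftUp` has the hard Lefschetz property. -/
theorem isLefschetz_shiftUp {N : ℕ} (hα : Fintype.card α = N + 1) :
    IsLefschetz (shiftUp (Finset α)) N := by
  intro i k
  induction k with
  | zero => exact fun _ f _ h => h
  | succ k ih =>
    intro hk f hf h
    -- Applying `D` to `U ^ (k + 1) f = 0` gives `U ^ k (UDf + c f) = 0`. Since `UDf + c f` again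
    -- has rank `i`, the induction hypothesis makes it vanish.
    set c : ℚ := ((k : ℚ) + 1) * (N - 2 * i - k) with hc
    have hcpos : 0 < c := by
      have : (2 * i + (k + 1) : ℚ) ≤ N := by exact_mod_cast hk
      exact mul_pos (by positivity) (by linarith)
    have hUD : shiftUp _ (shiftDown _ f) ∈ rankSpace (EdgePoset (Finset α)) i := by
      rcases i with _ | i
      · intro e he
        have : shiftDown _ f = 0 := by
          classical
          ext e
          rw [shiftDown_apply]
          refine Finset.sum_eq_zero fun e' he' => hf e' ?_
          have hs : IsShift e e' := (Finset.mem_filter.1 he').2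
          have hg : grade ℕ e + 1 = grade ℕ e' := Nat.covBy_iff_add_one_eq.1 (hs.1.grade ℕ)
          omega
        rw [this, map_zero, Pi.zero_apply]
      · have := isRankRaising_shiftUp.pow_mem 1 (shiftDown_mem_rankSpace hf)
        rwa [pow_one] at this
    have h0 : shiftUp _ (shiftDown _ f) + c • f = 0 := by
      refine ih (by omega) _ (Submodule.add_mem _ hUD (Submodule.smul_mem _ c hf)) ?_
      rw [map_add, map_smul, ← Module.End.mul_apply, ← pow_succ, hc,
        ← shiftDown_shiftUp_pow hα hf, h, map_zero]
    -- Pairing with `f` gives `⟨Df, Df⟩ + c ⟨f, f⟩ = 0`, and `c > 0` forces `f = 0`.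
    have h1 : ∑ e, (shiftUp _ (shiftDown _ f) + c • f) e * f e = 0 := by
      rw [h0]
      simp
    simp only [Pi.add_apply, add_mul, Finset.sum_add_distrib, sum_shiftUp_mul, Pi.smul_apply,
      smul_eq_mul, mul_assoc] at h1
    rw [← Finset.mul_sum] at h1
    have h2 : 0 ≤ ∑ e, shiftDown _ f e * shiftDown _ f e :=
      Finset.sum_nonneg fun e _ => mul_self_nonneg _
    have h3 : 0 ≤ ∑ e, f e * f e := Finset.sum_nonneg fun e _ => mul_self_nonneg _
    have h4 : ∑ e, f e * f e = 0 := by nlinarith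
    ext e
    exact mul_self_eq_zero.1
      ((Finset.sum_eq_zero_iff_of_nonneg fun e _ => mul_self_nonneg _).1 h4 e (Finset.mem_univ e))

end EdgePoset

/-! ### Descent of equivariant operators to the quotient -/

namespace QuotientPoset

variable {G P : Type*} [Group G] [MulAction G P]

/-- The operator induced on functions on the quotient by an equivariant operator `U`. -/
noncomputable def quotientOperator (G : Type*) {P : Type*} [Group G] [MulAction G P]
    (U : (P → ℚ) →ₗ[ℚ] (P → ℚ)) : (QuotientPoset G P → ℚ) →ₗ[ℚ] (QuotientPoset G P → ℚ) :=
  (LinearMap.funLeft ℚ ℚ (Function.surjInv mk_surjective)).comp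
    (U.comp (LinearMap.funLeft ℚ ℚ mk))

variable {U : (P → ℚ) →ₗ[ℚ] (P → ℚ)}

/-- By equivariance `U (f ∘ mk)` is constant on orbits, so the representative chosen in
`quotientOperator` does not matter. -/
theorem quotientOperator_comp_mk (hU : ∀ (g : G) f p, U (fun x => f (g • x)) p = U f (g • p))
    (f : QuotientPoset G P → ℚ) : quotientOperator G U f ∘ mk = U (f ∘ mk) := by
  ext p
  have h : (mk (Function.surjInv mk_surjective (mk p)) : QuotientPoset G P) = mk p :=
    Function.surjInv_eq mk_surjective (mk p)
  obtain ⟨g, hg⟩ := mk_eq_iff.1 h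
  change U (f ∘ mk) (Function.surjInv mk_surjective (mk p)) = U (f ∘ mk) p
  rw [← hg, ← hU]
  refine congrFun (congrArg U (funext fun x => ?_)) p
  exact congrArg f (mk_eq_iff.2 ⟨g, rfl⟩)

theorem quotientOperator_pow_comp_mk
    (hU : ∀ (g : G) f p, U (fun x => f (g • x)) p = U f (g • p))
    (f : QuotientPoset G P → ℚ) (k : ℕ) :
    (quotientOperator G U ^ k) f ∘ mk = (U ^ k) (f ∘ mk) := by
  induction k with
  | zero => rfl
  | succ k ih =>
    rw [pow_succ', pow_succ', Module.End.mul_apply, Module.End.mul_apply, ← ih,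
      quotientOperator_comp_mk hU]

variable [PartialOrder P] [GradeOrder ℕ P] [IsGradedAction G P]

theorem grade_mk (p : P) : grade ℕ (mk p : QuotientPoset G P) = grade ℕ p := rfl

theorem isRankRaising_quotientOperator
    (hU : ∀ (g : G) f p, U (fun x => f (g • x)) p = U f (g • p)) (hR : IsRankRaising U) :
    IsRankRaising (quotientOperator G U) := by
  intro f q h
  obtain ⟨p, rfl⟩ := mk_surjective q
  rw [← Function.comp_apply (f := quotientOperator G U f), quotientOperator_comp_mk hU]
  refine hR _ _ fun p' hp' hg => h (mk p') (lt_of_le_of_ne ⟨p', p, rfl, rfl, hp'.le⟩ ?_) hg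
  intro he
  have := congrArg (grade ℕ) he
  rw [grade_mk, grade_mk] at this
  omega

/-- Pulling back along `mk` is injective, preserves ranks and intertwines the operators, so the
quotient inherits injectivity as a subspace would. -/
theorem isLefschetz_quotientOperator
    (hU : ∀ (g : G) f p, U (fun x => f (g • x)) p = U f (g • p)) {N : ℕ} (hL : IsLefschetz U N) :
    IsLefschetz (quotientOperator G U) N := by
  intro i k hik f hf h0
  have h1 : (U ^ k) (f ∘ mk) = 0 := by
    rw [← quotientOperator_pow_comp_mk hU, h0]
    rfl
  have h2 := hL i k hik (f ∘ mk) (fun p hp => hf (mk p) hp) h1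
  ext q
  obtain ⟨p, rfl⟩ := mk_surjective q
  exact congrFun h2 p

end QuotientPoset

/-! ### Equivariance, complementation and the ranks of the quotient -/

namespace EdgePoset

theorem isShift_smul_iff {G P : Type*} [Group G] [PartialOrder P] [GradeOrder ℕ P]
    [MulAction G P] [IsGradedAction G P] (g : G) (e e' : EdgePoset P) :
    IsShift (g • e) (g • e') ↔ IsShift e e' := by
  have key : ∀ (g : G) (e e' : EdgePoset P), IsShift e e' → IsShift (g • e) (g • e') :=
    fun g e e' h => ⟨IsGradedAction.smul_covBy g h.1, IsGradedAction.smul_covBy g h.2.1,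
      fun h' => h.2.2 (MulAction.injective g h')⟩
  refine ⟨fun h => ?_, key g e e'⟩
  simpa using key g⁻¹ _ _ h

theorem shiftUp_smul {G P : Type*} [Group G] [PartialOrder P] [GradeOrder ℕ P]
    [MulAction G P] [IsGradedAction G P] [Fintype (EdgePoset P)] (g : G) (f : EdgePoset P → ℚ)
    (e : EdgePoset P) : shiftUp P (fun x => f (g • x)) e = shiftUp P f (g • e) := by
  classical
  rw [shiftUp_apply, shiftUp_apply, Finset.sum_filter, Finset.sum_filter,
    ← Equiv.sum_comp (MulAction.toPerm g) fun x => if IsShift x (g • e) then f x else 0]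
  simp [isShift_smul_iff]

/-- The anti-automorphism of the edge poset of a Boolean algebra given by complements. -/
def compl {P : Type*} [BooleanAlgebra P] (e : EdgePoset P) : EdgePoset P :=
  ⟨e.sndᶜ, e.fstᶜ, ((apply_covBy_apply_iff (OrderIso.compl P)).2 e.covBy).ofDual⟩

theorem compl_compl {P : Type*} [BooleanAlgebra P] (e : EdgePoset P) : e.compl.compl = e :=
  EdgePoset.ext (_root_.compl_compl _) (_root_.compl_compl _)

variable {n : ℕ} {G : Subgroup (Finset (Fin n) ≃o Finset (Fin n))}

theorem compl_smul (g : G) (e : EdgePoset (Finset (Fin n))) : (g • e).compl = g • e.compl :=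
  EdgePoset.ext (map_compl' (g : Finset (Fin n) ≃o Finset (Fin n)) e.snd).symm
    (map_compl' (g : Finset (Fin n) ≃o Finset (Fin n)) e.fst).symm

theorem mk_compl_eq_iff (e e' : EdgePoset (Finset (Fin n))) :
    (QuotientPoset.mk e.compl : QuotientPoset G _) = QuotientPoset.mk e'.compl ↔
      (QuotientPoset.mk e : QuotientPoset G _) = QuotientPoset.mk e' := by
  rw [QuotientPoset.mk_eq_iff, QuotientPoset.mk_eq_iff]
  refine exists_congr fun g => ?_
  rw [← compl_smul]
  exact (Function.LeftInverse.injective compl_compl).eq_iff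

/-- Complementation induces an injection on orbits and sends `(x, y)` to an edge of rank `|yᶜ| = N -
|x|`. The resulting inequality, used at `i` and at `N - i`, gives equality. -/
theorem isRankSymmetric_quotient {N : ℕ} (hn : n = N + 1) :
    IsRankSymmetric (QuotientPoset G (EdgePoset (Finset (Fin n)))) N := by
  have key : ∀ i ≤ N, rankNumber (QuotientPoset G (EdgePoset (Finset (Fin n)))) i ≤
      rankNumber (QuotientPoset G (EdgePoset (Finset (Fin n)))) (N - i) := by
    intro i hi
    let r := Function.surjInv (QuotientPoset.mk_surjective (G := G)
      (P := EdgePoset (Finset (Fin n))))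
    have hr : ∀ q, QuotientPoset.mk (r q) = q := Function.surjInv_eq _
    refine Set.ncard_le_ncard_of_injOn (fun q => QuotientPoset.mk (r q).compl) ?_ ?_
      (Set.toFinite _)
    · intro q hq
      have h1 : grade ℕ (r q) = i := by
        rw [← QuotientPoset.grade_mk (G := G), hr]
        exact hq
      have h2 := card_compl_snd_add_grade (N := N) (by simp [hn]) (r q)
      change (r q).sndᶜ.card = N - i
      omega
    · intro q _ q' _ h
      rw [← hr q, ← hr q']
      exact (mk_compl_eq_iff _ _).1 h
  intro i hi
  refine (key i hi).antisymm ?_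
  have := key (N - i) (Nat.sub_le _ _)
  rwa [Nat.sub_sub_self hi] at this

theorem isOfRank_quotient {N : ℕ} (hn : n = N + 1) :
    IsOfRank (QuotientPoset G (EdgePoset (Finset (Fin n)))) N := by
  subst hn
  refine ⟨fun q => ?_, fun _ => ⟨?_, ?_⟩⟩
  · obtain ⟨e, rfl⟩ := QuotientPoset.mk_surjective q
    have := card_compl_snd_add_grade (N := N) (by simp) e
    rw [QuotientPoset.grade_mk]
    omega
  · exact ⟨QuotientPoset.mk ⟨∅, insert 0 ∅, Finset.covBy_insert (by simp)⟩, rfl⟩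
  · refine ⟨QuotientPoset.mk ⟨{0}ᶜ, insert 0 {0}ᶜ, Finset.covBy_insert (by simp)⟩, ?_⟩
    change ({0}ᶜ : Finset (Fin (N + 1))).card = N
    simp [Finset.card_compl]

end EdgePoset

/-! ### The empty case and the conclusion -/

theorem isPeck_of_isEmpty (P : Type*) [PartialOrder P] [GradeOrder ℕ P] [IsEmpty P] : IsPeck P := by
  refine ⟨0, ⟨isEmptyElim, fun h => isEmptyElim h.some⟩, fun i hi => ?_, ⟨0, le_rfl, ?_, ?_⟩,
    fun k A _ _ => ⟨Finset.range k, Finset.card_range k, ?_⟩⟩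
  · rw [Nat.le_zero.1 hi]
  · intro i hi
    omega
  · intro i _ hi
    omega
  · rw [Set.eq_empty_of_isEmpty (⋃ j, A j), Set.ncard_empty]
    exact Nat.zero_le _

theorem mainTheorem2 (n : ℕ) (G : Subgroup (Finset (Fin n) ≃o Finset (Fin n))) :
    IsPeck (QuotientPoset G (EdgePoset (Finset (Fin n)))) := by
  rcases n with _ | N
  · have : IsEmpty (QuotientPoset G (EdgePoset (Finset (Fin 0)))) := by
      refine ⟨fun q => ?_⟩
      obtain ⟨e, rfl⟩ := QuotientPoset.mk_surjective q
      exact e.covBy.lt.ne (Subsingleton.elim _ _)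
    exact isPeck_of_isEmpty _
  have := Fintype.ofFinite (EdgePoset (Finset (Fin (N + 1))))
  have hL := QuotientPoset.isLefschetz_quotientOperator (G := G) EdgePoset.shiftUp_smul
    (EdgePoset.isLefschetz_shiftUp (α := Fin (N + 1)) (N := N) (by simp))
  have hU := QuotientPoset.isRankRaising_quotientOperator (G := G) EdgePoset.shiftUp_smul
    (EdgePoset.isRankRaising_shiftUp (P := Finset (Fin (N + 1))))
  have hN := EdgePoset.isOfRank_quotient (G := G) rfl
  have hsym := EdgePoset.isRankSymmetric_quotient (G := G) rfl
  exact ⟨N, hN, hsym, hL.isRankUnimodal hU hsym, hL.isStronglySperner hU hN.1 hsym⟩
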